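/- Let $(\Omega,\mathcal F,\mu)$ be a complete $\sigma$-finite measure space, let $(H_\omega)_{\omega\in\Omega}$ be a family of real Hilbert spaces, and let $\mathfrak G$ be a vector subspace of $\prod_{\omega\in\Omega}H_\omega$ such that: (A) for every $x\in\mathfrak G$, the function $\omega\mapsto\|x(\omega)\|$ is $\mathcal F$-measurable; (B) every $x\in\prod_{\omega\in\Omega}H_\omega$ for which $\omega\mapsto\langle x(\omega),y(\omega)\rangle$ is $\mathcal F$-measurable for all $y\in\mathfrak G$ belongs to $\mathfrak G$; (C) there is a sequence $(e_n)_{n\in\mathbb N}$ in $\mathfrak G$ such that, for every $\omega\in\Omega$, the closed linear span of $\{e_n(\omega)\}_{n\in\mathbb N}$ is $H_\omega$. Let $\mathfrak H$ be the set of all $x\in\mathfrak G$ with $\int_\Omega\|x(\omega)\|^2\,\mu(d\omega)<+\infty$, and let $\mathcal H$ be the Hilbert space of equivalence classes of $\mu$-a.e. equal elements of $\mathfrak H$, with scalar product $\langle x,y\rangle=\int_\Omega\langle x(\omega),y(\omega)\rangle\,\mu(d\omega)$; the same letter denotes a class and a representative of it. Direct integrals are defined as follows. - For sets $D_\omega\subset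 H_\omega$: ${\int_\Omega^\oplus}D_\omega\,\mu(d\omega)=\{x\in\mathcal H: x(\omega)\in D_\omega\text{ for }\mu\text{-a.e. }\omega\}$. - For set-valued operators $A_\omega\colon H_\omega\to 2^{H_\omega}$: $\big({\int_\Omega^\oplus}A_\omega\,\mu(d\omega)\big)(x)=\{x^*\in\mathcal H: x^*(\omega)\in A_\omega(x(\omega))\text{ for }\mu\text{-a.e. }\omega\}$, for every $x\in\mathcal H$. Single-valued operators are identified with the set-valued operators whose values are singletons. - For functions $f_\omega\colon H_\omega\to[-\infty,+\infty]$ such that $\omega\mapsto f_\omega(x(\omega))$ is $\mathcal F$-measurable for every $x\in\mathfrak H$: $\big({\int_\Omega^\oplus}f_\omega\,\mu(d\omega)\big)(x)=\int_\Omega f_\omega(x(\omega))\,\mu(d\omega)$, for every $x\in\mathcal H$, where the integral of a function $\vartheta$ is set to $+\infty$ whenever $\int_\Omega\max\{\vartheta,0\}\,d\mu=+\infty$. For a nonempty closed convex subset $D$ of a real Hilbert space, $\mathrm{proj}_D$ is the projector onto $D$, $d_D$ is the distance function to $D$, $\sigma_D(u)=\sup_{x\in D}\langle x,u\rangle\in[-\infty,+\infty]$,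 $N_D(x)=\{u:\langle y-x,u\rangle\le 0\text{ for all }y\in D\}$ if $x\in D$ and $N_D(x)=\varnothing$ otherwise, $D^\ominus=\{u:\langle x,u\rangle\le 0\text{ for all }x\in D\}$, and $D^\perp=\{u:\langle x,u\rangle=0\text{ for all }x\in D\}$. For every $\omega\in\Omega$, let $C_\omega$ be a nonempty closed convex subset of $H_\omega$, and set $C={\int_\Omega^\oplus}C_\omega\,\mu(d\omega)$. Suppose that $C\neq\varnothing$ and that, for every $x\in\mathfrak H$, the mapping $\omega\mapsto\mathrm{proj}_{C_\omega}(x(\omega))$ lies in $\mathfrak G$. Then the following hold: (i) $C$ is a closed convex subset of $\mathcal H$. (ii) $N_C={\int_\Omega^\oplus}N_{C_\omega}\,\mu(d\omega)$. (iii) $\mathrm{proj}_C={\int_\Omega^\oplus}\mathrm{proj}_{C_\omega}\,\mu(d\omega)$. (iv) ${\int_\Omega^\oplus}d_{C_\omega}^2\,\mu(d\omega)$ is well defined, that is, $\omega\mapsto d_{C_\omega}^2(x(\omega))$ is $\mathcal F$-measurable for every $x\in\mathfrak H$, and $d_C^2={\int_\Omega^\oplus}d_{C_\omega}^2\,\mu(d\omega)$.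 (v) ${\int_\Omega^\oplus}\sigma_{C_\omega}\,\mu(d\omega)$ is well defined, that is, $\omega\mapsto\sigma_{C_\omega}(x(\omega))$ is $\mathcal F$-measurable for every $x\in\mathfrak H$, and $\sigma_C={\int_\Omega^\oplus}\sigma_{C_\omega}\,\mu(d\omega)$. (vi) If $C_\omega$ is a cone (that is, $tC_\omega\subset C_\omega$ for every $t>0$) for every $\omega\in\Omega$, then $C^\ominus={\int_\Omega^\oplus}C_\omega^\ominus\,\mu(d\omega)$. (vii) If $C_\omega$ is a vector subspace of $H_\omega$ for every $\omega\in\Omega$, then $C^\perp={\int_\Omega^\oplus}C_\omega^\perp\,\mu(d\omega)$. -/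

import Mathlib

open MeasureTheory Set

noncomputable section

namespace HilbertDirectIntegral

universe u v

/-! ## Convex-analytic notions in one real inner product space -/

section OneSpace

variable {E : Type v} [NormedAddCommGroup E] [InnerProductSpace ℝ E]

open Classical in
/-- The projection operator `proj_C`: the point of `C` nearest to `x`. It is the usual projector
whenever nearest points exist and are unique, as for a nonempty closed convex subset of a Hilbert
space; the value is `x` if there is no nearest point. -/
def proj (C : Set E) (x : E) : E :=
  if h : ∃ p ∈ C, ∀ y ∈ C, ‖x - p‖ ≤ ‖x - y‖ then h.choose else x

/-- The normal cone operator `N_C`, as a set-valued operator. -/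
def normalCone (C : Set E) (x : E) : Set E :=
  {u | x ∈ C ∧ ∀ y ∈ C, inner ℝ (y - x) u ≤ 0}

/-- The support function `σ_C(u) = sup_{x ∈ C} ⟪x, u⟫`, with values in `[-∞, +∞]`. -/
def supportFun (C : Set E) (u : E) : EReal :=
  ⨆ x ∈ C, ((inner ℝ x u : ℝ) : EReal)

/-- The squared distance function `d_C²`, as a function with values in `[-∞, +∞]`. -/
def sqDist (C : Set E) (x : E) : EReal :=
  ((Metric.infDist x C ^ 2 : ℝ) : EReal)

/-- The polar cone `C^⊖`. -/
def polarCone (C : Set E) : Set E :=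
  {u | ∀ x ∈ C, inner ℝ x u ≤ 0}

/-- The orthogonal complement `C^⊥` of a set. -/
def orthCompl (C : Set E) : Set E :=
  {u | ∀ x ∈ C, inner ℝ x u = 0}

/-- `C` is a cone: it is stable under multiplication by positive scalars. -/
def IsCone (C : Set E) : Prop :=
  ∀ t : ℝ, 0 < t → ∀ x ∈ C, t • x ∈ C

/-- `C` is (the underlying set of) a vector subspace. -/
def IsVectorSubspace (C : Set E) : Prop :=
  ∃ V : Submodule ℝ E, (V : Set E) = C

end OneSpace

/-! ## The integral of an extended-real-valued function -/

open Classical in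
/-- The integral of `θ : Ω → [-∞, +∞]`, equal to `+∞` as soon as the integral of the positive part
is `+∞`, and to the integral of the positive part minus that of the negative part otherwise. -/
def erealIntegral {Ω : Type u} [MeasurableSpace Ω] (μ : Measure Ω) (θ : Ω → EReal) : EReal :=
  if ∫⁻ ω, (θ ω).toENNReal ∂μ = ⊤ then ⊤
  else ((∫⁻ ω, (θ ω).toENNReal ∂μ : ENNReal) : EReal)
    - ((∫⁻ ω, (-θ ω).toENNReal ∂μ : ENNReal) : EReal)

/-! ## Measurable vector fields of Hilbert spaces and their direct integrals -/

variable {Ω : Type u} [MeasurableSpace Ω] (H : Ω → Type v)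
  [∀ ω, NormedAddCommGroup (H ω)] [∀ ω, InnerProductSpace ℝ (H ω)]

/-- A space `G` of vector fields turning `(H ω)` into a measurable vector field of real Hilbert
spaces (completeness of each `H ω` is a separate type class assumption). -/
structure MeasurableField where
  /-- the vector subspace `𝔊` of the product of the spaces `H ω` -/
  G : Submodule ℝ (∀ ω, H ω)
  measurable_norm : ∀ x ∈ G, Measurable fun ω => ‖x ω‖
  mem_of_measurable_inner : ∀ x : ∀ ω, H ω,
    (∀ y ∈ G, Measurable fun ω => (inner ℝ (x ω) (y ω) : ℝ)) → x ∈ G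
  exists_total : ∃ e : ℕ → ∀ ω, H ω, (∀ n, e n ∈ G) ∧
    ∀ ω, closure (Submodule.span ℝ (range fun n => e n ω) : Set (H ω)) = univ

variable {H}
variable (𝔊 : MeasurableField H) (μ : Measure Ω)

theorem measurable_inner {x y : ∀ ω, H ω} (hx : x ∈ 𝔊.G) (hy : y ∈ 𝔊.G) :
    Measurable fun ω => (inner ℝ (x ω) (y ω) : ℝ) := by
  have h1 := 𝔊.measurable_norm _ (𝔊.G.add_mem hx hy)
  have h2 := 𝔊.measurable_norm _ (𝔊.G.sub_mem hx hy)
  have : (fun ω => (inner ℝ (x ω) (y ω) : ℝ)) = fun ω =>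
      (‖(x + y) ω‖ * ‖(x + y) ω‖ - ‖(x - y) ω‖ * ‖(x - y) ω‖) / 4 := by
    funext ω
    have h3 := norm_add_mul_self_real (x ω) (y ω)
    have h4 := norm_sub_mul_self_real (x ω) (y ω)
    simp only [Pi.add_apply, Pi.sub_apply]
    linarith
  rw [this]
  exact ((h1.mul h1).sub (h2.mul h2)).div_const 4

theorem integrable_inner {x y : ∀ ω, H ω} (hx : x ∈ 𝔊.G) (hy : y ∈ 𝔊.G)
    (hx2 : Integrable (fun ω => ‖x ω‖ ^ 2) μ) (hy2 : Integrable (fun ω => ‖y ω‖ ^ 2) μ) :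
    Integrable (fun ω => (inner ℝ (x ω) (y ω) : ℝ)) μ := by
  refine (hx2.add hy2).mono' (measurable_inner 𝔊 hx hy).aestronglyMeasurable
    (Filter.Eventually.of_forall fun ω => ?_)
  have h := abs_real_inner_le_norm (x ω) (y ω)
  simp only [Real.norm_eq_abs, Pi.add_apply]
  nlinarith [sq_nonneg (‖x ω‖ - ‖y ω‖), sq_nonneg (‖x ω‖), sq_nonneg (‖y ω‖)]

/-- The space `𝔥` of the vector fields in `𝔊` that are square-integrable. -/
def sqIntegrable : Submodule ℝ (∀ ω, H ω) where
  carrier := {x | x ∈ 𝔊.G ∧ Integrable (fun ω => ‖x ω‖ ^ 2) μ}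
  zero_mem' := ⟨𝔊.G.zero_mem, by simp⟩
  add_mem' := by
    rintro x y ⟨hx, hx2⟩ ⟨hy, hy2⟩
    refine ⟨𝔊.G.add_mem hx hy, ?_⟩
    have h := (hx2.add ((integrable_inner 𝔊 μ hx hy hx2 hy2).const_mul 2)).add hy2
    refine h.congr (Filter.Eventually.of_forall fun ω => ?_)
    exact (norm_add_sq_real (x ω) (y ω)).symm
  smul_mem' := by
    rintro c x ⟨hx, hx2⟩
    refine ⟨𝔊.G.smul_mem c hx, ?_⟩
    simpa [norm_smul, mul_pow] using hx2.const_mul (c ^ 2)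

/-- The subspace of `𝔥` of the vector fields that vanish almost everywhere. -/
def aeZero : Submodule ℝ (sqIntegrable 𝔊 μ) where
  carrier := {x | ∀ᵐ ω ∂μ, x.1 ω = 0}
  zero_mem' := by simp
  add_mem' := by
    intro x y (hx : ∀ᵐ ω ∂μ, x.1 ω = 0) (hy : ∀ᵐ ω ∂μ, y.1 ω = 0)
    change ∀ᵐ ω ∂μ, (x + y).1 ω = 0
    filter_upwards [hx, hy] with ω h1 h2
    simp [h1, h2]
  smul_mem' := by
    intro c x (hx : ∀ᵐ ω ∂μ, x.1 ω = 0)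
    change ∀ᵐ ω ∂μ, (c • x).1 ω = 0
    filter_upwards [hx] with ω h1
    simp [h1]

/-- The Hilbert direct integral of the spaces `H ω` relative to `𝔊`: the equivalence classes of
almost everywhere equal elements of `𝔥`. -/
def DirectIntegral : Type (max u v) := sqIntegrable 𝔊 μ ⧸ aeZero 𝔊 μ

namespace DirectIntegral

variable {𝔊 μ}

instance : AddCommGroup (DirectIntegral 𝔊 μ) :=
  inferInstanceAs (AddCommGroup (sqIntegrable 𝔊 μ ⧸ aeZero 𝔊 μ))

instance : Module ℝ (DirectIntegral 𝔊 μ) :=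
  inferInstanceAs (Module ℝ (sqIntegrable 𝔊 μ ⧸ aeZero 𝔊 μ))

variable (𝔊 μ) in
/-- The equivalence class of an element of `𝔥`. -/
def mk : sqIntegrable 𝔊 μ →ₗ[ℝ] DirectIntegral 𝔊 μ := (aeZero 𝔊 μ).mkQ

theorem mk_surjective : Function.Surjective (mk 𝔊 μ) := (aeZero 𝔊 μ).mkQ_surjective

theorem mk_eq_mk_iff (x y : sqIntegrable 𝔊 μ) :
    mk 𝔊 μ x = mk 𝔊 μ y ↔ ∀ᵐ ω ∂μ, x.1 ω = y.1 ω := by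
  refine (Submodule.Quotient.eq (aeZero 𝔊 μ)).trans ?_
  change (∀ᵐ ω ∂μ, x.1 ω - y.1 ω = 0) ↔ _
  simp only [sub_eq_zero]

/-- A representative in `𝔥` of an element of the direct integral. -/
def rep (x : DirectIntegral 𝔊 μ) : sqIntegrable 𝔊 μ := Function.surjInv mk_surjective x

/-- The value `x(ω)` of a representative of `x`. -/
instance : CoeFun (DirectIntegral 𝔊 μ) fun _ => ∀ ω, H ω := ⟨fun x => (rep x).1⟩

theorem mk_rep (x : DirectIntegral 𝔊 μ) : mk 𝔊 μ (rep x) = x := Function.surjInv_eq _ x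

theorem rep_mk (x : sqIntegrable 𝔊 μ) : ∀ᵐ ω ∂μ, (mk 𝔊 μ x) ω = x.1 ω :=
  (mk_eq_mk_iff _ _).1 (mk_rep _)

theorem ext_ae {x y : DirectIntegral 𝔊 μ} (h : ∀ᵐ ω ∂μ, x ω = y ω) : x = y := by
  rw [← mk_rep x, ← mk_rep y]
  exact (mk_eq_mk_iff _ _).2 h

theorem coe_add (x y : DirectIntegral 𝔊 μ) : ∀ᵐ ω ∂μ, (x + y) ω = x ω + y ω := by
  have h := rep_mk (rep x + rep y)
  rwa [map_add, mk_rep, mk_rep] at h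

theorem coe_smul (c : ℝ) (x : DirectIntegral 𝔊 μ) : ∀ᵐ ω ∂μ, (c • x) ω = c • x ω := by
  have h := rep_mk (c • rep x)
  rwa [map_smul, mk_rep] at h

theorem coe_zero : ∀ᵐ ω ∂μ, (0 : DirectIntegral 𝔊 μ) ω = 0 := by
  have h := rep_mk (0 : sqIntegrable 𝔊 μ)
  rwa [map_zero] at h

theorem integrable_inner_coe (x y : DirectIntegral 𝔊 μ) :
    Integrable (fun ω => (inner ℝ (x ω) (y ω) : ℝ)) μ :=
  integrable_inner 𝔊 μ (rep x).2.1 (rep y).2.1 (rep x).2.2 (rep y).2.2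

/-- The scalar product `⟪x, y⟫ = ∫ ⟪x(ω), y(ω)⟫ μ(dω)`. -/
@[reducible]
def core : InnerProductSpace.Core ℝ (DirectIntegral 𝔊 μ) where
  inner x y := ∫ ω, (inner ℝ (x ω) (y ω) : ℝ) ∂μ
  conj_inner_symm x y := by
    simp only [conj_trivial]
    exact integral_congr_ae (Filter.Eventually.of_forall fun ω => real_inner_comm _ _)
  re_inner_nonneg x := integral_nonneg fun ω => real_inner_self_nonneg
  add_left x y z := by
    rw [← integral_add (integrable_inner_coe x z) (integrable_inner_coe y z)]
    refine integral_congr_ae ?_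
    filter_upwards [coe_add x y] with ω h
    rw [h, inner_add_left]
  smul_left x y c := by
    simp only [conj_trivial]
    rw [← integral_const_mul]
    refine integral_congr_ae ?_
    filter_upwards [coe_smul c x] with ω h
    rw [h, real_inner_smul_left]
  definite x hx := by
    have h := (integral_eq_zero_iff_of_nonneg (fun ω => real_inner_self_nonneg)
      (integrable_inner_coe x x)).1 hx
    refine ext_ae ?_
    filter_upwards [h, coe_zero (𝔊 := 𝔊) (μ := μ)] with ω h1 h2
    rw [h2]
    exact inner_self_eq_zero.1 h1

instance : NormedAddCommGroup (DirectIntegral 𝔊 μ) := core.toNormedAddCommGroup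

instance : InnerProductSpace ℝ (DirectIntegral 𝔊 μ) := InnerProductSpace.ofCore core.toCore

theorem inner_def (x y : DirectIntegral 𝔊 μ) :
    (inner ℝ x y : ℝ) = ∫ ω, (inner ℝ (x ω) (y ω) : ℝ) ∂μ := rfl

end DirectIntegral

/-- The Hilbert direct integral of the sets `C ω` relative to `𝔊`. -/
def directIntegralSet (C : ∀ ω, Set (H ω)) : Set (DirectIntegral 𝔊 μ) :=
  {x | ∀ᵐ ω ∂μ, x ω ∈ C ω}

/-- The Hilbert direct integral of the set-valued operators `A ω` relative to `𝔊`. -/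
def directIntegralOp (A : ∀ ω, H ω → Set (H ω)) (x : DirectIntegral 𝔊 μ) :
    Set (DirectIntegral 𝔊 μ) :=
  {x' | ∀ᵐ ω ∂μ, x' ω ∈ A ω (x ω)}

/-- The measurability condition under which the direct integral of the functions `f ω` is
defined. -/
def FunctionsMeasurable (f : ∀ ω, H ω → EReal) : Prop :=
  ∀ x ∈ sqIntegrable 𝔊 μ, Measurable fun ω => f ω (x ω)

/-- The Hilbert direct integral of the functions `f ω` relative to `𝔊`. -/
def directIntegralFun (f : ∀ ω, H ω → EReal) (x : DirectIntegral 𝔊 μ) : EReal :=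
  erealIntegral μ fun ω => f ω (x ω)

end HilbertDirectIntegral

end

/-! Everything reduces to one fact: projecting pointwise onto the fibres gives the nearest point of
the direct integral. If `r` is a square-integrable selection, nonexpansiveness gives `‖proj (K ω) (x
ω) - r ω‖ ≤ ‖x ω - r ω‖`, so the pointwise projection is again square-integrable
(`IsProjectable.proj_mem`). It minimises the distance in almost every fibre, hence also after
integration. So the direct integral has nearest points, with no appeal to completeness of the global
space. A set with nearest points is closed. The distance, the normal cone (`u ∈ N(x)` iff `proj (x +
u) = x`) and the polar of a closed cone (its normal cone at 0) are all expressed through the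
projection, so they too are computed fibrewise. The support function needs more: exchanging supremum
and integral. One inequality is monotonicity of the integral. For the other, projecting a sequence
of square-integrable fields that is dense in every fibre gives dense selections
(`exists_dense_selections`); gluing them measurably gives selections whose scalar products with `u`
increase to the fibrewise support function, and monotone convergence concludes. -/

open MeasureTheory Set

noncomputable section

namespace HilbertDirectIntegral

universe u v

/-! ### Nearest points, normal cones and dense sets in a single space -/

section OneSpace

variable {E : Type v} [NormedAddCommGroup E] {C : Set E}

/-- Every point has a nearest point in `C`. -/
def HasNearestPoints (C : Set E) : Prop :=
  ∀ x, ∃ p ∈ C, ∀ y ∈ C, ‖x - p‖ ≤ ‖x - y‖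

namespace HasNearestPoints

theorem proj_mem (h : HasNearestPoints C) (x : E) : proj C x ∈ C := by
  rw [proj, dif_pos (h x)]
  exact (h x).choose_spec.1

theorem norm_sub_proj_le (h : HasNearestPoints C) (x : E) {y : E} (hy : y ∈ C) :
    ‖x - proj C x‖ ≤ ‖x - y‖ := by
  rw [proj, dif_pos (h x)]
  exact (h x).choose_spec.2 y hy

/-- A point of the closure is at distance zero from `C`, hence equals its nearest point. This gives
closedness of the direct integral without extracting a.e. convergent subsequences. -/
theorem isClosed (h : HasNearestPoints C) : IsClosed C := by
  refine isClosed_of_closure_subset fun x hx => ?_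
  have h0 : ‖x - proj C x‖ ≤ 0 := by
    refine le_of_forall_pos_le_add fun ε hε => ?_
    obtain ⟨y, hy, hxy⟩ := Metric.mem_closure_iff.1 hx ε hε
    rw [dist_eq_norm] at hxy
    linarith [h.norm_sub_proj_le x hy]
  rw [sub_eq_zero.1 (norm_le_zero_iff.1 h0)]
  exact h.proj_mem x

theorem infDist_eq (h : HasNearestPoints C) (x : E) : Metric.infDist x C = ‖x - proj C x‖ := by
  refine le_antisymm ?_ ?_
  · rw [← dist_eq_norm]
    exact Metric.infDist_le_dist_of_mem (h.proj_mem x)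
  · refine (Metric.le_infDist ⟨_, h.proj_mem x⟩).2 fun {y} hy => ?_
    rw [dist_eq_norm]
    exact h.norm_sub_proj_le x hy

theorem proj_of_mem (h : HasNearestPoints C) {x : E} (hx : x ∈ C) : proj C x = x := by
  have h1 := h.norm_sub_proj_le x hx
  rw [sub_self, norm_zero] at h1
  exact (sub_eq_zero.1 (norm_le_zero_iff.1 h1)).symm

end HasNearestPoints

variable [InnerProductSpace ℝ E]

theorem nearest_iff_sub_mem_normalCone (hC : Convex ℝ C) {x p : E} (hp : p ∈ C) :
    (∀ y ∈ C, ‖x - p‖ ≤ ‖x - y‖) ↔ x - p ∈ normalCone C p := by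
  have hne : Nonempty C := ⟨⟨p, hp⟩⟩
  have hbdd : BddBelow (range fun w : C => ‖x - w‖) :=
    ⟨0, by rintro _ ⟨w, rfl⟩; exact norm_nonneg _⟩
  have h1 : (∀ y ∈ C, ‖x - p‖ ≤ ‖x - y‖) ↔ ‖x - p‖ = ⨅ w : C, ‖x - w‖ := by
    constructor
    · intro h
      exact le_antisymm (le_ciInf fun w => h w w.2) (ciInf_le hbdd ⟨p, hp⟩)
    · intro h y hy
      rw [h]
      exact ciInf_le hbdd ⟨y, hy⟩
  rw [h1, norm_eq_iInf_iff_real_inner_le_zero hC hp]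
  constructor
  · exact fun h => ⟨hp, fun y hy => by rw [real_inner_comm]; exact h y hy⟩
  · exact fun h y hy => by rw [real_inner_comm]; exact h.2 y hy

theorem hasNearestPoints_of_isClosed [CompleteSpace E] (hne : C.Nonempty) (hcl : IsClosed C)
    (hC : Convex ℝ C) : HasNearestPoints C := by
  intro x
  obtain ⟨p, hp, h⟩ := exists_norm_eq_iInf_of_complete_convex hne hcl.isComplete hC x
  refine ⟨p, hp, fun y hy => ?_⟩
  rw [h]
  exact ciInf_le ⟨0, by rintro _ ⟨w, rfl⟩; exact norm_nonneg _⟩ (⟨y, hy⟩ : C)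

namespace HasNearestPoints

theorem sub_proj_mem_normalCone (h : HasNearestPoints C) (hC : Convex ℝ C) (x : E) :
    x - proj C x ∈ normalCone C (proj C x) :=
  (nearest_iff_sub_mem_normalCone hC (h.proj_mem x)).1 fun _ hy => h.norm_sub_proj_le x hy

/-- Adding the variational inequalities at the two projections gives firm nonexpansiveness, `‖p -
q‖² ≤ ⟪p - q, x - y⟫`; Cauchy–Schwarz does the rest. -/
theorem norm_proj_sub_proj_le (h : HasNearestPoints C) (hC : Convex ℝ C) (x y : E) :
    ‖proj C x - proj C y‖ ≤ ‖x - y‖ := by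
  have h1 := (h.sub_proj_mem_normalCone hC x).2 _ (h.proj_mem y)
  have h2 := (h.sub_proj_mem_normalCone hC y).2 _ (h.proj_mem x)
  set p := proj C x
  set q := proj C y
  have h3 : ‖p - q‖ ^ 2 ≤ inner ℝ (p - q) (x - y) := by
    have e : (inner ℝ (p - q) (x - y) : ℝ) =
        ‖p - q‖ ^ 2 - inner ℝ (q - p) (x - p) - inner ℝ (p - q) (y - q) := by
      rw [← real_inner_self_eq_norm_sq, ← neg_sub p q, inner_neg_left, sub_neg_eq_add,
        ← inner_add_right, ← inner_sub_right]
      congr 1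
      abel
    linarith
  have h4 := real_inner_le_norm (p - q) (x - y)
  by_contra! hlt
  nlinarith [norm_nonneg (p - q), norm_nonneg (x - y)]

/-- Two points satisfying the variational inequality coincide: tested against each other, the
inequalities sum to `‖q - p‖² ≤ 0`. As `proj` is defined by choice, this is what identifies its
value. -/
theorem proj_eq_iff (h : HasNearestPoints C) (hC : Convex ℝ C) {x p : E} :
    proj C x = p ↔ x - p ∈ normalCone C p := by
  constructor
  · rintro rfl
    exact h.sub_proj_mem_normalCone hC x
  · intro hp
    have h1 := (h.sub_proj_mem_normalCone hC x).2 _ hp.1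
    have h2 := hp.2 _ (h.proj_mem x)
    set q := proj C x
    have e : ‖q - p‖ ^ 2 = inner ℝ (p - q) (x - q) + inner ℝ (q - p) (x - p) := by
      rw [← real_inner_self_eq_norm_sq, ← neg_sub q p, inner_neg_left, neg_add_eq_sub,
        ← inner_sub_right]
      congr 1
      abel
    have h3 : ‖q - p‖ ^ 2 ≤ 0 := by linarith
    exact sub_eq_zero.1 (norm_eq_zero.1 (pow_eq_zero_iff two_ne_zero |>.1
      (le_antisymm h3 (sq_nonneg _))))

theorem mem_normalCone_iff (h : HasNearestPoints C) (hC : Convex ℝ C) {x u : E} :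
    u ∈ normalCone C x ↔ proj C (x + u) = x := by
  rw [h.proj_eq_iff hC, add_sub_cancel_left]

theorem continuous_proj (h : HasNearestPoints C) (hC : Convex ℝ C) : Continuous (proj C) :=
  (LipschitzWith.of_dist_le_mul (K := 1) fun x y => by
    simpa [dist_eq_norm] using h.norm_proj_sub_proj_le hC x y).continuous

end HasNearestPoints

/-- Only positive scalars are allowed in a cone, so 0 is reached as the limit of `t • x` when `t`
decreases to 0. -/
theorem IsCone.zero_mem (hC : IsCone C) (hne : C.Nonempty) (hcl : IsClosed C) : (0 : E) ∈ C := by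
  obtain ⟨x, hx⟩ := hne
  have h : Filter.Tendsto (fun t : ℝ => t • x) (nhdsWithin 0 (Ioi 0)) (nhds ((0 : ℝ) • x)) :=
    ((continuous_id.smul continuous_const).tendsto 0).mono_left nhdsWithin_le_nhds
  rw [zero_smul] at h
  refine hcl.mem_of_tendsto h ?_
  filter_upwards [self_mem_nhdsWithin] with t ht
  exact hC t ht x hx

theorem normalCone_zero (h0 : (0 : E) ∈ C) : normalCone C 0 = polarCone C := by
  ext u
  simp [normalCone, polarCone, h0]

theorem IsVectorSubspace.isCone (hC : IsVectorSubspace C) : IsCone C := by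
  obtain ⟨V, rfl⟩ := hC
  exact fun t _ x hx => V.smul_mem t hx

theorem IsVectorSubspace.neg_mem (hC : IsVectorSubspace C) : ∀ x ∈ C, -x ∈ C := by
  obtain ⟨V, rfl⟩ := hC
  exact fun x hx => V.neg_mem hx

theorem orthCompl_eq_polarCone (hC : ∀ x ∈ C, -x ∈ C) : orthCompl C = polarCone C := by
  ext u
  refine ⟨fun h x hx => (h x hx).le, fun h x hx => le_antisymm (h x hx) ?_⟩
  have := h _ (hC x hx)
  rw [inner_neg_left] at this
  linarith

theorem supportFun_eq_iSup_of_dense {ι : Type*} {z : ι → E} (hz : ∀ i, z i ∈ C)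
    (hd : C ⊆ closure (range z)) (u : E) :
    supportFun C u = ⨆ i, ((inner ℝ (z i) u : ℝ) : EReal) := by
  refine le_antisymm (iSup₂_le fun x hx => ?_)
    (iSup_le fun i => le_iSup₂ (f := fun x (_ : x ∈ C) => ((inner ℝ x u : ℝ) : EReal)) _ (hz i))
  have hcl : IsClosed {x : E | ((inner ℝ x u : ℝ) : EReal) ≤
      ⨆ i, ((inner ℝ (z i) u : ℝ) : EReal)} :=
    isClosed_le (continuous_coe_real_ereal.comp (continuous_id.inner continuous_const))
      continuous_const
  refine closure_minimal ?_ hcl (hd hx)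
  rintro _ ⟨i, rfl⟩
  exact le_iSup (fun i => ((inner ℝ (z i) u : ℝ) : EReal)) i

/-- The combination of the vectors `e i` with rational coefficients `c i`. -/
def ratCombination (e : ℕ → E) (c : ℕ →₀ ℚ) : E :=
  c.sum fun i q => (q : ℝ) • e i

theorem ratCombination_single (e : ℕ → E) (i : ℕ) :
    ratCombination e (Finsupp.single i 1) = e i := by
  simp [ratCombination]

theorem ratCombination_add (e : ℕ → E) (c d : ℕ →₀ ℚ) :
    ratCombination e (c + d) = ratCombination e c + ratCombination e d := by
  refine Finsupp.sum_add_index' (fun i => ?_) fun i q r => ?_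
  · simp
  · simp [add_smul]

theorem ratCombination_smul (e : ℕ → E) (q : ℚ) (c : ℕ →₀ ℚ) :
    ratCombination e (q • c) = (q : ℝ) • ratCombination e c := by
  rw [ratCombination, Finsupp.sum_smul_index' fun i => by simp, ratCombination, Finsupp.smul_sum]
  simp [mul_smul]

/-- Rational coefficients make the index set countable; density of the rationals and joint
continuity of the operations recover the real span. -/
theorem dense_range_ratCombination {e : ℕ → E}
    (he : closure (Submodule.span ℝ (range e) : Set E) = univ) :
    closure (range (ratCombination e)) = univ := by
  refine eq_univ_of_univ_subset (he ▸ closure_minimal (fun x hx => ?_) isClosed_closure)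
  induction hx using Submodule.span_induction with
  | mem x hx =>
    obtain ⟨i, rfl⟩ := hx
    exact subset_closure ⟨_, ratCombination_single e i⟩
  | zero => exact subset_closure ⟨0, by simp [ratCombination]⟩
  | add x y _ _ hx hy =>
    refine map_mem_closure₂ continuous_add hx hy ?_
    rintro _ ⟨c, rfl⟩ _ ⟨d, rfl⟩
    exact ⟨c + d, ratCombination_add e c d⟩
  | smul r x _ hx =>
    refine map_mem_closure₂ (f := fun (r : ℝ) (x : E) => r • x) continuous_smul
      (Rat.denseRange_cast r) hx ?_
    rintro _ ⟨q, rfl⟩ _ ⟨c, rfl⟩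
    exact ⟨q • c, ratCombination_smul e q c⟩

end OneSpace

/-! ### The extended-real integral and monotone convergence -/

section ERealIntegral

variable {Ω : Type u} [MeasurableSpace Ω] {μ : Measure Ω}

/-- When the negative part has finite integral, the convention `+∞` agrees with the plain
difference, since `⊤` minus a real is `⊤`. -/
theorem erealIntegral_eq_sub {θ : Ω → EReal} (h : ∫⁻ ω, (-θ ω).toENNReal ∂μ ≠ ⊤) :
    erealIntegral μ θ = ((∫⁻ ω, (θ ω).toENNReal ∂μ : ENNReal) : EReal)
      - ((∫⁻ ω, (-θ ω).toENNReal ∂μ : ENNReal) : EReal) := by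
  rw [erealIntegral]
  split_ifs with h1
  · lift ∫⁻ ω, (-θ ω).toENNReal ∂μ to NNReal using h with b
    rw [h1, EReal.coe_ennreal_top]
    exact (EReal.top_sub_coe (b : ℝ)).symm
  · rfl

theorem lintegral_toENNReal_neg_coe_ne_top {f : Ω → ℝ} (hf : Integrable f μ) :
    ∫⁻ ω, (-(f ω : EReal)).toENNReal ∂μ ≠ ⊤ :=
  hf.neg.lintegral_lt_top.ne

theorem erealIntegral_coe {f : Ω → ℝ} (hf : Integrable f μ) :
    erealIntegral μ (fun ω => (f ω : EReal)) = ((∫ ω, f ω ∂μ : ℝ) : EReal) := by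
  have hneg : ∫⁻ ω, ENNReal.ofReal (-f ω) ∂μ ≠ ⊤ := hf.neg.lintegral_lt_top.ne
  rw [erealIntegral_eq_sub (lintegral_toENNReal_neg_coe_ne_top hf),
    integral_eq_lintegral_pos_part_sub_lintegral_neg_part hf, EReal.coe_sub,
    EReal.coe_ennreal_toReal hf.lintegral_lt_top.ne,
    EReal.coe_ennreal_toReal hneg]
  rfl

theorem erealIntegral_mono_ae {θ η : Ω → EReal} (h : ∀ᵐ ω ∂μ, θ ω ≤ η ω) :
    erealIntegral μ θ ≤ erealIntegral μ η := by
  have h1 : ∫⁻ ω, (θ ω).toENNReal ∂μ ≤ ∫⁻ ω, (η ω).toENNReal ∂μ :=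
    lintegral_mono_ae (h.mono fun ω hω => EReal.toENNReal_le_toENNReal hω)
  have h2 : ∫⁻ ω, (-η ω).toENNReal ∂μ ≤ ∫⁻ ω, (-θ ω).toENNReal ∂μ :=
    lintegral_mono_ae (h.mono fun ω hω => EReal.toENNReal_le_toENNReal (EReal.neg_le_neg_iff.2 hω))
  by_cases hη : ∫⁻ ω, (η ω).toENNReal ∂μ = ⊤
  · rw [erealIntegral, erealIntegral, if_pos hη]
    exact le_top
  · have hθ : ∫⁻ ω, (θ ω).toENNReal ∂μ ≠ ⊤ := ne_top_of_le_ne_top hη h1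
    rw [erealIntegral, erealIntegral, if_neg hη, if_neg hθ]
    exact EReal.sub_le_sub (EReal.coe_ennreal_le_coe_ennreal_iff.2 h1)
      (EReal.coe_ennreal_le_coe_ennreal_iff.2 h2)

open Filter Topology in
/-- Monotone convergence for an increasing sequence of integrable functions. -/
theorem tendsto_integral_erealIntegral_iSup {f : ℕ → Ω → ℝ} (hf : ∀ n, Integrable (f n) μ)
    (hmeas : ∀ n, Measurable (f n)) (hmono : ∀ ω, Monotone fun n => f n ω) :
    Tendsto (fun n => ((∫ ω, f n ω ∂μ : ℝ) : EReal)) atTop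
      (𝓝 (erealIntegral μ fun ω => ⨆ n, (f n ω : EReal))) := by
  have hlim : ∀ ω, Tendsto (fun n => (f n ω : EReal)) atTop (𝓝 (⨆ n, (f n ω : EReal))) :=
    fun ω => tendsto_atTop_iSup fun m n hmn => EReal.coe_le_coe_iff.2 (hmono ω hmn)
  have hpos : Tendsto (fun n => ∫⁻ ω, (f n ω : EReal).toENNReal ∂μ) atTop
      (𝓝 (∫⁻ ω, (⨆ n, (f n ω : EReal)).toENNReal ∂μ)) :=
    lintegral_tendsto_of_tendsto_of_monotone
      (fun n => (hmeas n).coe_real_ereal.ereal_toENNReal.aemeasurable)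
      (Eventually.of_forall fun ω m n hmn =>
        EReal.toENNReal_le_toENNReal (EReal.coe_le_coe_iff.2 (hmono ω hmn)))
      (Eventually.of_forall fun ω => (EReal.continuous_toENNReal.tendsto _).comp (hlim ω))
  have hneg : Tendsto (fun n => ∫⁻ ω, (-(f n ω : EReal)).toENNReal ∂μ) atTop
      (𝓝 (∫⁻ ω, (-⨆ n, (f n ω : EReal)).toENNReal ∂μ)) :=
    lintegral_tendsto_of_tendsto_of_antitone
      (fun n => ((hmeas n).neg.coe_real_ereal).ereal_toENNReal.aemeasurable)
      (Eventually.of_forall fun ω m n hmn => EReal.toENNReal_le_toENNReal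
        (EReal.neg_le_neg_iff.2 (EReal.coe_le_coe_iff.2 (hmono ω hmn))))
      (lintegral_toENNReal_neg_coe_ne_top (hf 0))
      (Eventually.of_forall fun ω =>
        ((EReal.continuous_toENNReal.comp continuous_neg).tendsto _).comp (hlim ω))
  have hfin : ∫⁻ ω, (-⨆ n, (f n ω : EReal)).toENNReal ∂μ ≠ ⊤ :=
    ne_top_of_le_ne_top (lintegral_toENNReal_neg_coe_ne_top (hf 0))
      (lintegral_mono fun ω => EReal.toENNReal_le_toENNReal (EReal.neg_le_neg_iff.2
        (le_iSup (fun n => (f n ω : EReal)) 0)))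
  simp_rw [← erealIntegral_coe (hf _),
    erealIntegral_eq_sub (lintegral_toENNReal_neg_coe_ne_top (hf _)), erealIntegral_eq_sub hfin,
    sub_eq_add_neg]
  -- Addition on `EReal` is discontinuous only at `⊤ + ⊥` and `⊥ + ⊤`. The limit of the negative
  -- parts is finite and the positive part is never `⊥`, so both are avoided.
  have hcont := EReal.continuousAt_add
    (p := (((∫⁻ ω, (⨆ n, (f n ω : EReal)).toENNReal ∂μ : ENNReal) : EReal),
      -((∫⁻ ω, (-⨆ n, (f n ω : EReal)).toENNReal ∂μ : ENNReal) : EReal)))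
    (Or.inr (by simpa using hfin)) (Or.inl (by simp))
  exact hcont.tendsto.comp ((EReal.tendsto_coe_ennreal.2 hpos).prodMk_nhds
    (EReal.tendsto_coe_ennreal.2 hneg).neg)

end ERealIntegral

/-! ### Measurable fields: gluing, truncation, dense sequences -/

section Fields

variable {Ω : Type u} {H : Ω → Type v}
  [∀ ω, NormedAddCommGroup (H ω)] [∀ ω, InnerProductSpace ℝ (H ω)]

open Classical in
/-- The field that at each point takes the first value among `z 0, …, z n` with the largest scalar
product with `u`. -/
def maxSelection (z : ℕ → ∀ ω, H ω) (u : ∀ ω, H ω) : ℕ → ∀ ω, H ω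
  | 0 => z 0
  | n + 1 => {ω | (inner ℝ (maxSelection z u n ω) (u ω) : ℝ)
      < inner ℝ (z (n + 1) ω) (u ω)}.piecewise (z (n + 1)) (maxSelection z u n)

theorem maxSelection_mem {z : ℕ → ∀ ω, H ω} (u : ∀ ω, H ω) {ω : Ω} {S : Set (H ω)}
    (hz : ∀ n, z n ω ∈ S) (n : ℕ) : maxSelection z u n ω ∈ S := by
  induction n with
  | zero => exact hz 0
  | succ n ih =>
    rw [maxSelection, piecewise]
    split_ifs
    · exact hz _
    · exact ih

theorem inner_maxSelection_succ (z : ℕ → ∀ ω, H ω) (u : ∀ ω, H ω) (n : ℕ) (ω : Ω) :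
    (inner ℝ (maxSelection z u (n + 1) ω) (u ω) : ℝ) =
      max (inner ℝ (maxSelection z u n ω) (u ω)) (inner ℝ (z (n + 1) ω) (u ω)) := by
  rw [maxSelection, piecewise]
  split_ifs with hlt
  · exact (max_eq_right (le_of_lt hlt)).symm
  · exact (max_eq_left (not_lt.1 hlt)).symm

theorem monotone_inner_maxSelection (z : ℕ → ∀ ω, H ω) (u : ∀ ω, H ω) (ω : Ω) :
    Monotone fun n => (inner ℝ (maxSelection z u n ω) (u ω) : ℝ) :=
  monotone_nat_of_le_succ fun n => by
    rw [inner_maxSelection_succ]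
    exact le_max_left _ _

theorem inner_le_inner_maxSelection (z : ℕ → ∀ ω, H ω) (u : ∀ ω, H ω) (n : ℕ) (ω : Ω) :
    (inner ℝ (z n ω) (u ω) : ℝ) ≤ inner ℝ (maxSelection z u n ω) (u ω) := by
  cases n with
  | zero => exact le_rfl
  | succ n =>
    rw [inner_maxSelection_succ]
    exact le_max_right _ _

/-- Trades the supremum over a dense sequence for an increasing one attained by selections of `S`,
as monotone convergence requires. -/
theorem supportFun_eq_iSup_maxSelection {z : ℕ → ∀ ω, H ω} (u : ∀ ω, H ω) {ω : Ω}
    {S : Set (H ω)} (hz : ∀ n, z n ω ∈ S) (hd : S ⊆ closure (range fun n => z n ω)) :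
    supportFun S (u ω) = ⨆ n, ((inner ℝ (maxSelection z u n ω) (u ω) : ℝ) : EReal) := by
  refine le_antisymm ?_ (iSup_le fun n => le_iSup₂
    (f := fun x (_ : x ∈ S) => ((inner ℝ x (u ω) : ℝ) : EReal)) _ (maxSelection_mem u hz n))
  rw [supportFun_eq_iSup_of_dense hz hd]
  exact iSup_mono fun n => EReal.coe_le_coe_iff.2 (inner_le_inner_maxSelection z u n ω)

variable [MeasurableSpace Ω] {𝔊 : MeasurableField H} {μ : Measure Ω}

theorem MeasurableField.piecewise_mem {x y : ∀ ω, H ω} (hx : x ∈ 𝔊.G) (hy : y ∈ 𝔊.G)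
    {S : Set Ω} [∀ ω, Decidable (ω ∈ S)] (hS : MeasurableSet S) : S.piecewise x y ∈ 𝔊.G := by
  refine 𝔊.mem_of_measurable_inner _ fun z hz => ?_
  have h : Measurable (S.piecewise (fun ω => (inner ℝ (x ω) (z ω) : ℝ))
      fun ω => inner ℝ (y ω) (z ω)) :=
    (measurable_inner 𝔊 hx hz).piecewise hS (measurable_inner 𝔊 hy hz)
  convert h using 1
  funext ω
  by_cases hω : ω ∈ S <;> simp [hω]

theorem mem_sqIntegrable_of_le {x : ∀ ω, H ω} (hx : x ∈ 𝔊.G) {g : Ω → ℝ} (hg : Integrable g μ)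
    (h : ∀ᵐ ω ∂μ, ‖x ω‖ ^ 2 ≤ g ω) : x ∈ sqIntegrable 𝔊 μ :=
  ⟨hx, hg.mono' ((𝔊.measurable_norm x hx).pow_const 2).aestronglyMeasurable
    (h.mono fun ω hω => by rwa [Real.norm_of_nonneg (sq_nonneg _)])⟩

theorem piecewise_mem_sqIntegrable {x y : ∀ ω, H ω} (hx : x ∈ sqIntegrable 𝔊 μ)
    (hy : y ∈ sqIntegrable 𝔊 μ) {S : Set Ω} [∀ ω, Decidable (ω ∈ S)] (hS : MeasurableSet S) :
    S.piecewise x y ∈ sqIntegrable 𝔊 μ := by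
  refine mem_sqIntegrable_of_le (MeasurableField.piecewise_mem hx.1 hy.1 hS) (hx.2.add hy.2)
    (Filter.Eventually.of_forall fun ω => ?_)
  have h1 := sq_nonneg ‖x ω‖
  have h2 := sq_nonneg ‖y ω‖
  by_cases hω : ω ∈ S <;> simp [hω]

theorem maxSelection_mem_sqIntegrable {z : ℕ → ∀ ω, H ω} {u : ∀ ω, H ω}
    (hz : ∀ n, z n ∈ sqIntegrable 𝔊 μ) (hu : u ∈ 𝔊.G) (n : ℕ) :
    maxSelection z u n ∈ sqIntegrable 𝔊 μ := by
  induction n with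
  | zero => exact hz 0
  | succ n ih =>
    exact piecewise_mem_sqIntegrable (hz _) ih
      (measurableSet_lt (measurable_inner 𝔊 ih.1 hu) (measurable_inner 𝔊 (hz _).1 hu))

/-- A measurable field is pointwise an element of some sequence of square-integrable fields. -/
theorem exists_truncation [SigmaFinite μ] {x : ∀ ω, H ω} (hx : x ∈ 𝔊.G) :
    ∃ t : ℕ → sqIntegrable 𝔊 μ, ∀ ω, ∃ k, (t k).1 ω = x ω := by
  classical
  -- On `S k` the field is bounded and the measure is finite, so cutting off outside `S k` gives
  -- square-integrability; these sets exhaust `Ω`.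
  let S : ℕ → Set Ω := fun k => spanningSets μ k ∩ {ω | ‖x ω‖ ≤ k}
  have hS : ∀ k, MeasurableSet (S k) := fun k => (measurableSet_spanningSets μ k).inter
    (measurableSet_le (𝔊.measurable_norm x hx) measurable_const)
  have hfin : ∀ k, μ (S k) ≠ ⊤ := fun k =>
    ne_top_of_le_ne_top (measure_spanningSets_lt_top μ k).ne (measure_mono inter_subset_left)
  have hmem : ∀ k, (S k).piecewise x 0 ∈ sqIntegrable 𝔊 μ := fun k => by
    refine mem_sqIntegrable_of_le (MeasurableField.piecewise_mem hx 𝔊.G.zero_mem (hS k))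
      ((integrable_indicator_iff (hS k)).2 (integrableOn_const (C := (k : ℝ) ^ 2) (hfin k)))
      (Filter.Eventually.of_forall fun ω => ?_)
    by_cases hω : ω ∈ S k
    · simp only [piecewise_eq_of_mem _ _ _ hω, indicator_of_mem hω]
      exact pow_le_pow_left₀ (norm_nonneg _) hω.2 2
    · simp [hω]
  refine ⟨fun k => ⟨_, hmem k⟩, fun ω => ?_⟩
  obtain ⟨m, hm⟩ := exists_nat_ge ‖x ω‖
  have h1 : ω ∈ ⋃ i, spanningSets μ i := iUnion_spanningSets μ ▸ mem_univ ω
  obtain ⟨n, hn⟩ := mem_iUnion.1 h1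
  refine ⟨max m n, piecewise_eq_of_mem (S _) _ _ ⟨?_, hm.trans ?_⟩⟩
  · exact monotone_spanningSets μ (le_max_right m n) hn
  · exact_mod_cast le_max_left m n

theorem ratCombination_mem {e : ℕ → ∀ ω, H ω} (he : ∀ n, e n ∈ 𝔊.G) (c : ℕ →₀ ℚ) :
    (fun ω => ratCombination (fun n => e n ω) c) ∈ 𝔊.G := by
  have h : (fun ω => ratCombination (fun n => e n ω) c) =
      ∑ i ∈ c.support, (c i : ℝ) • e i := by
    funext ω
    simp [ratCombination, Finsupp.sum]
  rw [h]
  exact 𝔊.G.sum_mem fun i _ => 𝔊.G.smul_mem _ (he i)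

variable (𝔊 μ) in
-- Truncation is needed because the total sequence is only measurable, whereas projections are
-- controlled on square-integrable fields.
theorem exists_dense_fields [SigmaFinite μ] :
    ∃ q : ℕ → sqIntegrable 𝔊 μ, ∀ ω, closure (range fun n => (q n).1 ω) = univ := by
  obtain ⟨e, he, htot⟩ := 𝔊.exists_total
  choose t ht using fun c => exists_truncation (μ := μ) (ratCombination_mem he c)
  obtain ⟨φ, hφ⟩ := exists_surjective_nat ((ℕ →₀ ℚ) × ℕ)
  refine ⟨fun n => t (φ n).1 (φ n).2, fun ω => eq_univ_of_univ_subset ?_⟩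
  rw [← dense_range_ratCombination (htot ω)]
  refine closure_mono ?_
  rintro _ ⟨c, rfl⟩
  obtain ⟨k, hk⟩ := ht c ω
  obtain ⟨n, hn⟩ := hφ (c, k)
  exact ⟨n, by simp only [hn, hk]⟩

namespace DirectIntegral

theorem coe_sub (x y : DirectIntegral 𝔊 μ) : ∀ᵐ ω ∂μ, (x - y) ω = x ω - y ω := by
  have h := rep_mk (rep x - rep y)
  rwa [map_sub, mk_rep, mk_rep] at h

theorem norm_sq_eq (x : DirectIntegral 𝔊 μ) : ‖x‖ ^ 2 = ∫ ω, ‖x ω‖ ^ 2 ∂μ := by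
  rw [← real_inner_self_eq_norm_sq, inner_def]
  simp only [real_inner_self_eq_norm_sq]

theorem norm_le_norm_of_ae {x y : DirectIntegral 𝔊 μ} (h : ∀ᵐ ω ∂μ, ‖x ω‖ ≤ ‖y ω‖) :
    ‖x‖ ≤ ‖y‖ := by
  refine le_of_sq_le_sq ?_ (norm_nonneg y)
  rw [norm_sq_eq, norm_sq_eq]
  exact integral_mono_ae (rep x).2.2 (rep y).2.2
    (h.mono fun ω hω => pow_le_pow_left₀ (norm_nonneg _) hω 2)

end DirectIntegral

theorem convex_directIntegralSet {K : ∀ ω, Set (H ω)} (hK : ∀ ω, Convex ℝ (K ω)) :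
    Convex ℝ (directIntegralSet 𝔊 μ K) := by
  intro x hx y hy a b ha hb hab
  filter_upwards [hx, hy, DirectIntegral.coe_add (a • x) (b • y), DirectIntegral.coe_smul a x,
    DirectIntegral.coe_smul b y] with ω h1 h2 h3 h4 h5
  rw [h3, h4, h5]
  exact hK ω h1 h2 ha hb hab

/-! ### Fibrewise computation of the projection and its consequences -/

variable (𝔊 μ) in
/-- A field of convex sets with nearest points whose projections are measurable and which has a
square-integrable selection. -/
structure IsProjectable (K : ∀ ω, Set (H ω)) : Prop where
  hasNearestPoints : ∀ ω, HasNearestPoints (K ω)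
  convex : ∀ ω, Convex ℝ (K ω)
  proj_mem_G : ∀ x ∈ sqIntegrable 𝔊 μ, (fun ω => proj (K ω) (x ω)) ∈ 𝔊.G
  nonempty : (directIntegralSet 𝔊 μ K).Nonempty

namespace IsProjectable

open DirectIntegral

variable {K : ∀ ω, Set (H ω)}

theorem proj_mem (h : IsProjectable 𝔊 μ K) {x : ∀ ω, H ω} (hx : x ∈ sqIntegrable 𝔊 μ) :
    (fun ω => proj (K ω) (x ω)) ∈ sqIntegrable 𝔊 μ := by
  obtain ⟨r, hr⟩ := h.nonempty
  have hxr := (sqIntegrable 𝔊 μ).sub_mem hx (rep r).2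
  -- The bound comes from `‖p‖ ≤ ‖x - r‖ + ‖r‖` for the projection `p`, and `(a + b)² ≤ 2a² + 2b²`.
  refine mem_sqIntegrable_of_le (h.proj_mem_G x hx)
    ((hxr.2.const_mul 2).add ((rep r).2.2.const_mul 2)) ?_
  filter_upwards [hr] with ω hω
  have h1 := (h.hasNearestPoints ω).norm_proj_sub_proj_le (h.convex ω) (x ω) (r ω)
  rw [(h.hasNearestPoints ω).proj_of_mem hω] at h1
  have h2 := norm_le_norm_sub_add (proj (K ω) (x ω)) (r ω)
  simp only [Pi.sub_apply, Pi.add_apply]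
  nlinarith [sq_nonneg (‖x ω - r ω‖ - ‖r ω‖), norm_nonneg (proj (K ω) (x ω)),
    norm_nonneg (x ω - r ω), norm_nonneg (r ω)]

/-- The class of the pointwise projection of `x`. -/
def projClass (h : IsProjectable 𝔊 μ K) (x : DirectIntegral 𝔊 μ) : DirectIntegral 𝔊 μ :=
  DirectIntegral.mk 𝔊 μ ⟨_, h.proj_mem (rep x).2⟩

theorem coe_projClass (h : IsProjectable 𝔊 μ K) (x : DirectIntegral 𝔊 μ) :
    ∀ᵐ ω ∂μ, h.projClass x ω = proj (K ω) (x ω) := rep_mk _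

theorem projClass_mem (h : IsProjectable 𝔊 μ K) (x : DirectIntegral 𝔊 μ) : h.projClass x ∈ directIntegralSet 𝔊 μ K := by
  filter_upwards [h.coe_projClass x] with ω hω
  rw [hω]
  exact (h.hasNearestPoints ω).proj_mem _

theorem norm_sub_projClass_le (h : IsProjectable 𝔊 μ K) (x : DirectIntegral 𝔊 μ) {y : DirectIntegral 𝔊 μ}
    (hy : y ∈ directIntegralSet 𝔊 μ K) : ‖x - h.projClass x‖ ≤ ‖x - y‖ := by
  refine norm_le_norm_of_ae ?_
  filter_upwards [h.coe_projClass x, hy, coe_sub x (h.projClass x), coe_sub x y] with ω h1 h2 h3 h4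
  rw [h3, h4, h1]
  exact (h.hasNearestPoints ω).norm_sub_proj_le _ h2

theorem hasNearestPoints_directIntegralSet (h : IsProjectable 𝔊 μ K) :
    HasNearestPoints (directIntegralSet 𝔊 μ K) :=
  fun x => ⟨h.projClass x, h.projClass_mem x, fun _ hy => h.norm_sub_projClass_le x hy⟩

theorem convex_directIntegralSet (h : IsProjectable 𝔊 μ K) :
    Convex ℝ (directIntegralSet 𝔊 μ K) :=
  HilbertDirectIntegral.convex_directIntegralSet h.convex

theorem proj_directIntegralSet (h : IsProjectable 𝔊 μ K) (x : DirectIntegral 𝔊 μ) :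
    proj (directIntegralSet 𝔊 μ K) x = h.projClass x :=
  (h.hasNearestPoints_directIntegralSet.proj_eq_iff h.convex_directIntegralSet).2
    ((nearest_iff_sub_mem_normalCone h.convex_directIntegralSet (h.projClass_mem x)).1
      fun _ hy => h.norm_sub_projClass_le x hy)

theorem coe_proj_directIntegralSet (h : IsProjectable 𝔊 μ K) (x : DirectIntegral 𝔊 μ) :
    ∀ᵐ ω ∂μ, proj (directIntegralSet 𝔊 μ K) x ω = proj (K ω) (x ω) := by
  rw [h.proj_directIntegralSet x]
  exact h.coe_projClass x

theorem proj_eq_directIntegralOp (h : IsProjectable 𝔊 μ K) :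
    (fun x => {proj (directIntegralSet 𝔊 μ K) x}) =
      directIntegralOp 𝔊 μ (fun ω y => {proj (K ω) y}) := by
  funext x
  ext y
  change y = _ ↔ ∀ᵐ ω ∂μ, y ω = proj (K ω) (x ω)
  have hp := h.coe_proj_directIntegralSet x
  constructor
  · rintro rfl
    exact hp
  · intro hy
    refine ext_ae ?_
    filter_upwards [hp, hy] with ω h1 h2
    rw [h1, h2]

/-- Both sides say that `x` is the projection of `x + u`, globally or almost everywhere. -/
theorem normalCone_eq_directIntegralOp (h : IsProjectable 𝔊 μ K) :
    normalCone (directIntegralSet 𝔊 μ K) =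
      directIntegralOp 𝔊 μ (fun ω => normalCone (K ω)) := by
  funext x
  ext u
  rw [h.hasNearestPoints_directIntegralSet.mem_normalCone_iff h.convex_directIntegralSet]
  change _ ↔ ∀ᵐ ω ∂μ, u ω ∈ normalCone (K ω) (x ω)
  have hp := h.coe_proj_directIntegralSet (x + u)
  have hadd := coe_add x u
  constructor
  · intro hx
    rw [hx] at hp
    filter_upwards [hp, hadd] with ω h1 h2
    rw [(h.hasNearestPoints ω).mem_normalCone_iff (h.convex ω), ← h2, ← h1]
  · intro hu
    refine ext_ae ?_
    filter_upwards [hp, hadd, hu] with ω h1 h2 h3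
    rw [h1, h2, ((h.hasNearestPoints ω).mem_normalCone_iff (h.convex ω)).1 h3]

theorem functionsMeasurable_sqDist (h : IsProjectable 𝔊 μ K) :
    FunctionsMeasurable 𝔊 μ (fun ω => sqDist (K ω)) := by
  intro x hx
  simp only [sqDist, (h.hasNearestPoints _).infDist_eq]
  exact ((𝔊.measurable_norm _
    (𝔊.G.sub_mem hx.1 (h.proj_mem_G x hx))).pow_const 2).coe_real_ereal

theorem sqDist_eq_directIntegralFun (h : IsProjectable 𝔊 μ K) :
    sqDist (directIntegralSet 𝔊 μ K) = directIntegralFun 𝔊 μ (fun ω => sqDist (K ω)) := by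
  funext x
  rw [directIntegralFun]
  simp only [sqDist, (h.hasNearestPoints _).infDist_eq]
  rw [h.hasNearestPoints_directIntegralSet.infDist_eq, norm_sq_eq, erealIntegral_coe]
  · congr 1
    refine integral_congr_ae ?_
    filter_upwards [coe_sub x (proj (directIntegralSet 𝔊 μ K) x),
      h.coe_proj_directIntegralSet x] with ω h1 h2
    rw [h1, h2]
  · exact ((sqIntegrable 𝔊 μ).sub_mem (rep x).2 (h.proj_mem (rep x).2)).2

/-- A continuous map fixing `K ω` pointwise sends a dense sequence of the fibre to a sequence dense
in `K ω`. -/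
theorem exists_dense_selections [SigmaFinite μ] (h : IsProjectable 𝔊 μ K) :
    ∃ z : ℕ → sqIntegrable 𝔊 μ, ∀ ω, (∀ n, (z n).1 ω ∈ K ω) ∧
      K ω ⊆ closure (range fun n => (z n).1 ω) := by
  obtain ⟨q, hq⟩ := exists_dense_fields 𝔊 μ
  refine ⟨fun n => ⟨_, h.proj_mem (q n).2⟩, fun ω =>
    ⟨fun n => (h.hasNearestPoints ω).proj_mem _, fun x hx => ?_⟩⟩
  rw [← (h.hasNearestPoints ω).proj_of_mem hx]
  refine map_mem_closure ((h.hasNearestPoints ω).continuous_proj (h.convex ω))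
    (hq ω ▸ mem_univ x) ?_
  rintro _ ⟨n, rfl⟩
  exact ⟨n, rfl⟩

theorem functionsMeasurable_supportFun [SigmaFinite μ] (h : IsProjectable 𝔊 μ K) :
    FunctionsMeasurable 𝔊 μ (fun ω => supportFun (K ω)) := by
  obtain ⟨z, hz⟩ := h.exists_dense_selections
  intro x hx
  simp only [supportFun_eq_iSup_of_dense (hz _).1 (hz _).2]
  exact Measurable.iSup fun n => (measurable_inner 𝔊 (z n).2.1 hx.1).coe_real_ereal

theorem supportFun_eq_directIntegralFun [SigmaFinite μ] (h : IsProjectable 𝔊 μ K) :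
    supportFun (directIntegralSet 𝔊 μ K) =
      directIntegralFun 𝔊 μ (fun ω => supportFun (K ω)) := by
  funext u
  refine le_antisymm (iSup₂_le fun x hx => ?_) ?_
  · rw [inner_def, ← erealIntegral_coe (integrable_inner_coe x u)]
    refine erealIntegral_mono_ae ?_
    filter_upwards [hx] with ω hω
    exact le_iSup₂ (f := fun y (_ : y ∈ K ω) => ((inner ℝ y (u ω) : ℝ) : EReal)) _ hω
  · obtain ⟨z, hz⟩ := h.exists_dense_selections
    -- Each glued field defines an element of the direct integral of the sets, so its scalar product
    -- with `u` is at most the global support function; the bound passes to the limit.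
    have hmem := maxSelection_mem_sqIntegrable (fun n => (z n).2) (rep u).2.1
    rw [directIntegralFun]
    simp only [supportFun_eq_iSup_maxSelection u (hz _).1 (hz _).2]
    refine le_of_tendsto' (tendsto_integral_erealIntegral_iSup
      (fun n => integrable_inner 𝔊 μ (hmem n).1 (rep u).2.1 (hmem n).2 (rep u).2.2)
      (fun n => measurable_inner 𝔊 (hmem n).1 (rep u).2.1)
      (monotone_inner_maxSelection _ _)) fun n => ?_
    have hae := rep_mk (⟨_, hmem n⟩ : sqIntegrable 𝔊 μ)
    have hx : DirectIntegral.mk 𝔊 μ ⟨_, hmem n⟩ ∈ directIntegralSet 𝔊 μ K := by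
      filter_upwards [hae] with ω hω
      rw [hω]
      exact maxSelection_mem u (hz ω).1 n
    refine le_trans (le_of_eq ?_) (le_iSup₂ (f := fun y (_ : y ∈ directIntegralSet 𝔊 μ K) =>
      ((inner ℝ y u : ℝ) : EReal)) _ hx)
    rw [inner_def]
    congr 1
    refine integral_congr_ae ?_
    filter_upwards [hae] with ω hω
    rw [hω]

theorem polarCone_eq_directIntegralSet (h : IsProjectable 𝔊 μ K) (hcone : ∀ ω, IsCone (K ω)) :
    polarCone (directIntegralSet 𝔊 μ K) =
      directIntegralSet 𝔊 μ (fun ω => polarCone (K ω)) := by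
  have h0 : ∀ ω, (0 : H ω) ∈ K ω := fun ω =>
    (hcone ω).zero_mem ⟨_, (h.hasNearestPoints ω).proj_mem 0⟩ (h.hasNearestPoints ω).isClosed
  have hC0 : (0 : DirectIntegral 𝔊 μ) ∈ directIntegralSet 𝔊 μ K := by
    filter_upwards [coe_zero (𝔊 := 𝔊) (μ := μ)] with ω hω
    rw [hω]
    exact h0 ω
  rw [← normalCone_zero hC0, h.normalCone_eq_directIntegralOp]
  ext u
  change (∀ᵐ ω ∂μ, u ω ∈ normalCone (K ω) ((0 : DirectIntegral 𝔊 μ) ω)) ↔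
    ∀ᵐ ω ∂μ, u ω ∈ polarCone (K ω)
  refine Filter.eventually_congr ?_
  filter_upwards [coe_zero (𝔊 := 𝔊) (μ := μ)] with ω hω
  rw [hω, normalCone_zero (h0 ω)]

/-- For sets symmetric about 0 the orthogonal complement is the polar cone, which reduces the claim
to cones. -/
theorem orthCompl_eq_directIntegralSet (h : IsProjectable 𝔊 μ K)
    (hsub : ∀ ω, IsVectorSubspace (K ω)) :
    orthCompl (directIntegralSet 𝔊 μ K) =
      directIntegralSet 𝔊 μ (fun ω => orthCompl (K ω)) := by
  have hneg : ∀ x ∈ directIntegralSet 𝔊 μ K, -x ∈ directIntegralSet 𝔊 μ K := by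
    intro x hx
    filter_upwards [hx, coe_smul (-1) x] with ω h1 h2
    rw [← neg_one_smul ℝ x, h2, neg_one_smul]
    exact (hsub ω).neg_mem _ h1
  simp only [orthCompl_eq_polarCone hneg, orthCompl_eq_polarCone (hsub _).neg_mem]
  exact h.polarCone_eq_directIntegralSet fun ω => (hsub ω).isCone

end IsProjectable

end Fields

end HilbertDirectIntegral

end

open HilbertDirectIntegral in
theorem corollaryc {Ω : Type*} [MeasurableSpace Ω] (μ : MeasureTheory.Measure Ω)
    [MeasureTheory.SigmaFinite μ] [μ.IsComplete]
    (H : Ω → Type*) [∀ ω, NormedAddCommGroup (H ω)] [∀ ω, InnerProductSpace ℝ (H ω)]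
    [∀ ω, CompleteSpace (H ω)]
    (𝔊 : MeasurableField H)
    (K : ∀ ω, Set (H ω))
    (hK_nonempty : ∀ ω, (K ω).Nonempty)
    (hK_closed : ∀ ω, IsClosed (K ω))
    (hK_convex : ∀ ω, Convex ℝ (K ω))
    (C : Set (DirectIntegral 𝔊 μ))
    (hC : C = directIntegralSet 𝔊 μ K)
    (hC_nonempty : C.Nonempty)
    (hK_proj : ∀ x ∈ sqIntegrable 𝔊 μ, (fun ω => proj (K ω) (x ω)) ∈ 𝔊.G) :
    (IsClosed C ∧ Convex ℝ C) ∧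
    normalCone C = directIntegralOp 𝔊 μ (fun ω => normalCone (K ω)) ∧
    (fun x => {proj C x}) = directIntegralOp 𝔊 μ (fun ω y => {proj (K ω) y}) ∧
    (FunctionsMeasurable 𝔊 μ (fun ω => sqDist (K ω)) ∧
      sqDist C = directIntegralFun 𝔊 μ (fun ω => sqDist (K ω))) ∧
    (FunctionsMeasurable 𝔊 μ (fun ω => supportFun (K ω)) ∧
      supportFun C = directIntegralFun 𝔊 μ (fun ω => supportFun (K ω))) ∧
    ((∀ ω, IsCone (K ω)) →
      polarCone C = directIntegralSet 𝔊 μ (fun ω => polarCone (K ω))) ∧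
    ((∀ ω, IsVectorSubspace (K ω)) →
      orthCompl C = directIntegralSet 𝔊 μ (fun ω => orthCompl (K ω))) := by
  subst hC
  have h : IsProjectable 𝔊 μ K :=
    ⟨fun ω => hasNearestPoints_of_isClosed (hK_nonempty ω) (hK_closed ω) (hK_convex ω),
      hK_convex, hK_proj, hC_nonempty⟩
  exact ⟨⟨h.hasNearestPoints_directIntegralSet.isClosed, h.convex_directIntegralSet⟩,
    h.normalCone_eq_directIntegralOp, h.proj_eq_directIntegralOp,
    ⟨h.functionsMeasurable_sqDist, h.sqDist_eq_directIntegralFun⟩,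
    ⟨h.functionsMeasurable_supportFun, h.supportFun_eq_directIntegralFun⟩,
    h.polarCone_eq_directIntegralSet, h.orthCompl_eq_directIntegralSet⟩
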